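/- A polygon ring with $n \ge 2$ faces is a simple plane graph $Z$ formed by $n$ cycles (its faces) $p_1,\dots,p_n$ arranged cyclically, where $p_i$ has length $s_i$: for each $i$ (indices modulo $n$) the faces $p_{i-1}$ and $p_i$ are glued along an edge $e_i$, the edges $e_i$ and $e_{i+1}$ of $p_i$ have no common end, and different faces have no vertices or edges in common other than those of the glued edges $e_1,\dots,e_n$ (each identification being between consecutive faces). All faces run clockwise, so that two consecutive faces traverse their common edge in opposite directions. The ring has type $t(s_1,k_1)\cdots t(s_n,k_n)$ if there are exactly $k_i$ edges between $e_i$ and $e_{i+1}$ along the clockwise direction of $p_i$; thus $1\le k_i\le s_i-3$. For integers $k \ge 1$ and $m\ge k+3$ define a $9\times 9$ matrix $T_{m,k}$ as follows. Let $J$ be a cycle of length $m$ with edges $ab$ and $dc$ such that, in clockwise order, one passes through $b,a$, then after $k$ edges from $a$ one reaches $d$, and then $c$. Let $e$ be the neighbour of $d$ on $J$ other than $c$, and $f$ the neighbour of $c$ on $J$ other than $d$ (possibly $e=a$ or $f=b$). Let $J'$ be obtained from $J$ by removing the edge $dc$ and adding two new vertices $\kappa_1,\kappa_2$ and the edges $d\kappa_1$,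 $c\kappa_2$. For the rows $x=1,\dots,9$ let $(R_x,C_x)$ be, in this order, $(\emptyset,\emptyset)$, $(\{a\},\emptyset)$, $(\{b\},\emptyset)$, $(\{a,b\},\emptyset)$, $(\emptyset,\{a,b\})$, $(\{a\},\{b\})$, $(\{b\},\{a\})$, $(\emptyset,\{a\})$, $(\emptyset,\{b\})$. Then $T_{m,k}[x,y]$ is the number of maximal matchings $M$ of $J'-R_x$ that cover every vertex of $C_x$ and for which the set $S$, consisting of $R_x$ and of the vertices covered by $M$, satisfies the $y$-th of the following (mutually exclusive and exhaustive) conditions: (1) $\kappa_1,e,\kappa_2,f\in S$; (2) $\kappa_2,f\in S$, $\kappa_1\notin S$; (3) $\kappa_1,e\in S$, $\kappa_2\notin S$; (4) $\kappa_1,\kappa_2\notin S$; (5) $e,f\notin S$; (6) $\kappa_1,f\notin S$; (7) $\kappa_2,e\notin S$; (8) $\kappa_2,f\in S$, $e\notin S$; (9) $\kappa_1,e\in S$, $f\notin S$. Theorem. For every polygon ring $Z$ with $n$ faces and type $t(s_1,k_1)\cdots t(s_n,k_n)$, the number $\Psi(Z)$ of maximal matchings of $Z$ (matchings not contained in a larger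 matching) is $$\Psi(Z)=\operatorname{tr}\bigl(T_{s_1,k_1}T_{s_2,k_2}\cdots T_{s_n,k_n}\bigr).$$ -/

import Mathlib

/-- The number of maximal matchings of `G`.  A matching is a set of pairwise disjoint edges, in the
form of a subgraph `M` with `M.IsMatching`: its vertices are exactly the covered ones, and each is
on exactly one edge of `M`.  It is maximal if no other matching contains it. -/
noncomputable def numMaximalMatchings {V : Type*} (G : SimpleGraph V) : ℕ :=
  {M : G.Subgraph | Maximal SimpleGraph.Subgraph.IsMatching M}.ncard

/-- `M` is a maximal matching of the graph `G - R` obtained by deleting the vertices in `R`. -/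
def IsMaximalMatchingDeleting {V : Type*} (G : SimpleGraph V) (R : Set V) (M : G.Subgraph) : Prop :=
  Maximal (fun N : G.Subgraph =>
    N.IsMatching ∧ N ≤ (⊤ : G.Subgraph).deleteVerts R) M

/-- A polygon ring `G` of type `t(s₀,k₀) t(s₁,k₁) ⋯ t(sₙ₋₁,kₙ₋₁)`: an annular arrangement of `n`
faces, the `i`-th a cycle of length `s i`, in which consecutive faces are glued along an edge.
(The indices in `Fin n` are cyclic, so that `n - 1 + 1 = 0`.)

The vertices of the face `i` are listed clockwise as `face i 0, face i 1, …`.  It shares with the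
face `i - 1` the edge from `face i (-1)` to `face i 0`, and, after `k i` further edges, it shares
with the face `i + 1` the edge from `face i (k i)` to `face i (k i + 1)`.

All faces are listed clockwise and the ring lies in the plane, so two consecutive faces
run through their common edge in opposite directions (`glue_zero`, `glue_neg_one`). -/
structure PolygonRing {V : Type*} (G : SimpleGraph V) {n : ℕ} [NeZero n] (s k : Fin n → ℕ) where
  /-- There are at least two faces. -/
  two_le : 2 ≤ n
  /-- `1 ≤ k i ≤ s i - 3`: the two shared edges of a face have no common end. -/
  one_le : ∀ i, 1 ≤ k i
  add_three_le : ∀ i, k i + 3 ≤ s i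
  /-- The vertices of the faces in clockwise order. -/
  face : (i : Fin n) → ZMod (s i) → V
  face_injective : ∀ i, Function.Injective (face i)
  /-- `G` is composed of the faces. -/
  exists_face : ∀ v, ∃ i j, face i j = v
  adj_iff : ∀ u v, G.Adj u v ↔ ∃ i j, s(u, v) = s(face i j, face i (j + 1))
  /-- The face `i + 1` is glued to the face `i`. -/
  glue_zero : ∀ i, face (i + 1) 0 = face i (k i)
  glue_neg_one : ∀ i, face (i + 1) (-1) = face i (k i + 1)
  /-- Different faces have no vertices in common except the ends of the glued edges. -/
  eq_of_face_eq : ∀ i i' j j', i ≠ i' → face i j = face i' j' →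
    (i' = i + 1 ∧ (j = k i ∧ j' = 0 ∨ j = k i + 1 ∧ j' = -1)) ∨
    (i = i' + 1 ∧ (j' = k i' ∧ j = 0 ∨ j' = k i' + 1 ∧ j = -1))
  /-- Different faces have no edges in common except the glued ones.  For `3 ≤ n` this follows from
  the other conditions; for `n = 2` it says that the gluing creates no parallel edges. -/
  eq_of_edge_eq : ∀ i i' j j', i ≠ i' →
    s(face i j, face i (j + 1)) = s(face i' j', face i' (j' + 1)) →
    (i' = i + 1 ∧ j = k i ∧ j' = -1) ∨ (i = i' + 1 ∧ j' = k i' ∧ j = -1)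

/-- The auxiliary graph `J'` for an `m`-gon `J` with connection type `t(m,k)`.  The vertices of `J`
are `Sum.inl j`, `j : ZMod m`, in clockwise order.  With `b = -1`, `a = 0`, `d = k`, `c = k + 1`
there are `k` edges on the clockwise path between the edges `ab` and `dc`.  The edge `dc` is
removed, and pendant vertices `k₁ = Sum.inr 0` and `k₂ = Sum.inr 1` are attached to `d` and `c`. -/
def auxGraph (m k : ℕ) : SimpleGraph (ZMod m ⊕ Fin 2) :=
  SimpleGraph.fromRel fun u v =>
    (∃ j : ZMod m, j ≠ k ∧ u = Sum.inl j ∧ v = Sum.inl (j + 1)) ∨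
    (u = Sum.inl (k : ZMod m) ∧ v = Sum.inr 0) ∨
    (u = Sum.inl (k + 1 : ZMod m) ∧ v = Sum.inr 1)

/-- The set `R` of deleted vertices for each of the nine rows, in terms of the vertices `a, b`. -/
def rowDeleted {W : Type*} (a b : W) : Fin 9 → Set W :=
  ![∅, {a}, {b}, {a, b}, ∅, {a}, {b}, ∅, ∅]

/-- The set `C` of vertices required to be covered for each of the nine rows. -/
def rowCovered {W : Type*} (a b : W) : Fin 9 → Set W :=
  ![∅, ∅, ∅, ∅, {a, b}, {b}, {a}, {a}, {b}]

/-- The condition for each of the nine columns on the set `S` of vertices that are deleted or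
covered; `e` is the neighbour of `d` in `J - c` and `f` is the neighbour of `c` in `J - d`. -/
def columnCondition {W : Type*} (k₁ k₂ e f : W) (S : Set W) : Fin 9 → Prop :=
  ![k₁ ∈ S ∧ e ∈ S ∧ k₂ ∈ S ∧ f ∈ S,
    k₂ ∈ S ∧ f ∈ S ∧ k₁ ∉ S,
    k₁ ∈ S ∧ e ∈ S ∧ k₂ ∉ S,
    k₁ ∉ S ∧ k₂ ∉ S,
    e ∉ S ∧ f ∉ S,
    k₁ ∉ S ∧ f ∉ S,
    k₂ ∉ S ∧ e ∉ S,
    k₂ ∈ S ∧ f ∈ S ∧ e ∉ S,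
    k₁ ∈ S ∧ e ∈ S ∧ f ∉ S]

/-- The transition matrix `T_{m,k}`.  Its entry `(x, y)` is the number of maximal matchings of
`J' - R` that cover `C`, for the sets `R` and `C` of the row `x`, and satisfy the condition of the
column `y`.  (Each such matching satisfies exactly one of the nine column conditions.) -/
noncomputable def transitionMatrix (m k : ℕ) : Matrix (Fin 9) (Fin 9) ℕ :=
  Matrix.of fun x y =>
    let a : ZMod m ⊕ Fin 2 := Sum.inl 0
    let b : ZMod m ⊕ Fin 2 := Sum.inl (-1)
    let e : ZMod m ⊕ Fin 2 := Sum.inl (k - 1)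
    let f : ZMod m ⊕ Fin 2 := Sum.inl (k + 2)
    let k₁ : ZMod m ⊕ Fin 2 := Sum.inr 0
    let k₂ : ZMod m ⊕ Fin 2 := Sum.inr 1
    {M : (auxGraph m k).Subgraph |
      IsMaximalMatchingDeleting (auxGraph m k) (rowDeleted a b x) M ∧
      rowCovered a b x ⊆ M.verts ∧
      columnCondition k₁ k₂ e f (M.verts ∪ rowDeleted a b x) y}.ncard

/-! Cut the ring into its faces and give each glued edge to the later of its two faces. A maximal
matching then splits into one set of cycle edges per face, and the faces interact only at the ends
of the glued edges. Let `d` be such an end on face `i`, and let `e` be its neighbour there off the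
glued edge. Face `i + 1` has to know only one of three things about `d`: it is already covered in
face `i` (`deleted`); neither it nor `e` is covered, so that face `i + 1` must cover it lest the
edge `ed` could be added (`needed`); or it is uncovered but `e` is covered, so that nothing is
required (`free`).

The two ends of a glued edge give nine pairs of statuses, and these index both the rows and the
columns of `T_{m,k}`. In `J'` maximality puts the pendant edge at `d` into the matching exactly when
`d` is not covered along the cycle, so `κ₁` records whether the face covers `d`
(`columnCondition_iff`). An entry therefore counts the sets of cycle edges of one face with
prescribed incoming and outgoing statuses (`transitionMatrix_apply`).

The trace is a sum over cyclic sequences `q` of status pairs, each term being the product of the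
numbers of choices on the faces (`Matrix.trace_prod_ofFn`). Compatible choices glue to a maximal
matching (`IsComposed.isMatchingCode`), every maximal matching arises in this way
(`IsMatchingCode.exists_isComposed`), and it determines its sequence (`IsComposed.unique`). -/

/-! ### Maximal matchings as sets of edge indices. -/

section Coding

variable {V ι : Type*}

/-- `F` is the index set of a maximal matching of the graph with edges `ends e`, `e ∈ E`, after
deletion of the vertices in `R`. -/
structure IsMatchingCode (ends : ι → Sym2 V) (E : Set ι) (R : Set V) (F : Set ι) : Prop where
  subset : F ⊆ E
  disjoint : ∀ e ∈ F, ∀ e' ∈ F, ∀ v, v ∈ ends e → v ∈ ends e' → e = e'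
  avoid : ∀ e ∈ F, ∀ v ∈ ends e, v ∉ R
  maximal : ∀ e ∈ E, ∃ v ∈ ends e, v ∈ R ∨ ∃ e' ∈ F, v ∈ ends e'

/-- The vertices on the edges with index in `F`. -/
def coveredBy (ends : ι → Sym2 V) (F : Set ι) : Set V := {v | ∃ e ∈ F, v ∈ ends e}

/-- The subgraph formed by a set of edges and their ends. -/
def subgraphOfEdges (G : SimpleGraph V) (A : Set (Sym2 V)) (hA : A ⊆ G.edgeSet) : G.Subgraph where
  verts := {v | ∃ e ∈ A, v ∈ e}
  Adj u v := s(u, v) ∈ A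
  adj_sub h := hA h
  edge_vert h := ⟨_, h, Sym2.mem_mk_left _ _⟩
  symm := ⟨fun u v h => by rwa [Sym2.eq_swap]⟩

theorem SimpleGraph.Subgraph.IsMatching.mem_verts_iff {G : SimpleGraph V} {M : G.Subgraph}
    (hM : M.IsMatching) (v : V) : v ∈ M.verts ↔ ∃ e ∈ M.edgeSet, v ∈ e := by
  constructor
  · intro hv
    obtain ⟨w, hw, -⟩ := hM hv
    exact ⟨s(v, w), hw, Sym2.mem_mk_left _ _⟩
  · rintro ⟨e, he, hv⟩
    exact M.mem_verts_of_mem_edge he hv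

theorem SimpleGraph.Subgraph.IsMatching.ext_edgeSet {G : SimpleGraph V} {M N : G.Subgraph}
    (hM : M.IsMatching) (hN : N.IsMatching) (h : M.edgeSet = N.edgeSet) : M = N := by
  ext u v
  · rw [hM.mem_verts_iff, hN.mem_verts_iff, h]
  · rw [← SimpleGraph.Subgraph.mem_edgeSet, h, SimpleGraph.Subgraph.mem_edgeSet]

theorem SimpleGraph.Subgraph.IsMatching.edge_unique {G : SimpleGraph V} {M : G.Subgraph}
    (hM : M.IsMatching) {e e' : Sym2 V} (he : e ∈ M.edgeSet) (he' : e' ∈ M.edgeSet) {v : V}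
    (hv : v ∈ e) (hv' : v ∈ e') : e = e' := by
  obtain ⟨w, rfl⟩ := hv
  obtain ⟨w', rfl⟩ := hv'
  rw [hM.eq_of_adj_left (SimpleGraph.Subgraph.mem_edgeSet.1 he)
    (SimpleGraph.Subgraph.mem_edgeSet.1 he')]

theorem subgraphOfEdges_isMatching {G : SimpleGraph V} {A : Set (Sym2 V)} (hA : A ⊆ G.edgeSet)
    (h : ∀ e ∈ A, ∀ e' ∈ A, ∀ v, v ∈ e → v ∈ e' → e = e') :
    (subgraphOfEdges G A hA).IsMatching := by
  rintro v ⟨e, he, w, rfl⟩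
  refine ⟨w, he, fun w' hw' => ?_⟩
  have := h _ hw' _ he v (Sym2.mem_mk_left _ _) (Sym2.mem_mk_left _ _)
  exact Sym2.congr_right.1 this

theorem edgeSet_subgraphOfEdges {G : SimpleGraph V} {A : Set (Sym2 V)} (hA : A ⊆ G.edgeSet) :
    (subgraphOfEdges G A hA).edgeSet = A := by
  ext e
  induction e with
  | _ u v => rfl

theorem le_deleteVerts_iff {G : SimpleGraph V} {M : G.Subgraph} {R : Set V} :
    M ≤ (⊤ : G.Subgraph).deleteVerts R ↔ ∀ v ∈ M.verts, v ∉ R := by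
  constructor
  · intro h v hv
    exact (h.1 hv).2
  · intro h
    refine ⟨fun v hv => ⟨trivial, h v hv⟩, fun u v huv => ?_⟩
    rw [SimpleGraph.Subgraph.deleteVerts_adj]
    exact ⟨trivial, h u huv.fst_mem, trivial, h v huv.snd_mem, huv.adj_sub⟩

/-- An edge with no deleted or covered end could be added to `M`. If there is none, every edge of a
larger matching meets an edge of `M` and hence equals it. -/
theorem isMaximalMatchingDeleting_iff {G : SimpleGraph V} {M : G.Subgraph} {R : Set V} :
    IsMaximalMatchingDeleting G R M ↔ M.IsMatching ∧ (∀ v ∈ M.verts, v ∉ R) ∧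
      ∀ e ∈ G.edgeSet, ∃ v ∈ e, v ∈ R ∨ v ∈ M.verts := by
  unfold IsMaximalMatchingDeleting
  simp only [le_deleteVerts_iff]
  constructor
  · intro h
    obtain ⟨⟨hM, hR⟩, hmax⟩ := h
    refine ⟨hM, hR, fun e he => ?_⟩
    by_contra hcon
    push Not at hcon
    have hsub : insert e M.edgeSet ⊆ G.edgeSet :=
      Set.insert_subset he M.edgeSet_subset
    have hmatch : (subgraphOfEdges G _ hsub).IsMatching := by
      apply subgraphOfEdges_isMatching
      rintro e₁ (rfl | h₁) e₂ (rfl | h₂) v hv₁ hv₂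
      · rfl
      · exact absurd (M.mem_verts_of_mem_edge h₂ hv₂) (hcon v hv₁).2
      · exact absurd (M.mem_verts_of_mem_edge h₁ hv₁) (hcon v hv₂).2
      · exact hM.edge_unique h₁ h₂ hv₁ hv₂
    have hle : M ≤ subgraphOfEdges G _ hsub := by
      refine ⟨fun v hv => ?_, fun u v huv => Or.inr huv⟩
      obtain ⟨e', he', hv'⟩ := (hM.mem_verts_iff v).1 hv
      exact ⟨e', Or.inr he', hv'⟩
    have hge := hmax ⟨hmatch, ?_⟩ hle
    · induction e with
      | _ u v =>
        exact (hcon u (Sym2.mem_mk_left _ _)).2 (hge.1 ⟨_, Or.inl rfl, Sym2.mem_mk_left _ _⟩)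
    · rintro v ⟨e', rfl | he', hv'⟩
      · exact (hcon v hv').1
      · exact hR v (M.mem_verts_of_mem_edge he' hv')
  · rintro ⟨hM, hR, hmax⟩
    refine ⟨⟨hM, hR⟩, fun N hN hle => ?_⟩
    have key : ∀ e ∈ N.edgeSet, e ∈ M.edgeSet := by
      intro e he
      obtain ⟨v, hv, hv' | hv'⟩ := hmax e (N.edgeSet_subset he)
      · exact absurd hv' (hN.2 v (N.mem_verts_of_mem_edge he hv))
      · obtain ⟨e', he', hve'⟩ := (hM.mem_verts_iff v).1 hv'
        rwa [hN.1.edge_unique he (SimpleGraph.Subgraph.edgeSet_mono hle he') hv hve']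
    refine ⟨fun v hv => ?_, fun u v huv => key s(u, v) huv⟩
    obtain ⟨e, he, hve⟩ := (hN.1.mem_verts_iff v).1 hv
    exact (hM.mem_verts_iff v).2 ⟨e, key e he, hve⟩

/-- Maximal matchings correspond to their codes. -/
theorem ncard_isMaximalMatchingDeleting (G : SimpleGraph V) (ends : ι → Sym2 V) (E : Set ι)
    (hE : G.edgeSet = ends '' E) (hinj : Set.InjOn ends E) (R : Set V) (P : Set V → Prop) :
    {M : G.Subgraph | IsMaximalMatchingDeleting G R M ∧ P M.verts}.ncard =
      {F : Set ι | IsMatchingCode ends E R F ∧ P (coveredBy ends F)}.ncard := by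
  have hedge : ∀ M : G.Subgraph, ends '' {e ∈ E | ends e ∈ M.edgeSet} = M.edgeSet := by
    intro M
    ext e
    constructor
    · rintro ⟨i, hi, rfl⟩
      exact hi.2
    · intro he
      have := M.edgeSet_subset he
      rw [hE] at this
      obtain ⟨i, hi, rfl⟩ := this
      exact ⟨i, ⟨hi, he⟩, rfl⟩
  have hcov : ∀ M : G.Subgraph, M.IsMatching →
      coveredBy ends {e ∈ E | ends e ∈ M.edgeSet} = M.verts := by
    intro M hM
    ext v
    rw [hM.mem_verts_iff]
    nth_rw 2 [← hedge M]
    simp only [Set.exists_mem_image]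
    rfl
  refine Set.ncard_congr (fun M _ => {e ∈ E | ends e ∈ M.edgeSet}) ?_ ?_ ?_
  · rintro M ⟨hmax, hP⟩
    obtain ⟨hM, hR, hmax⟩ := isMaximalMatchingDeleting_iff.1 hmax
    refine ⟨⟨fun e he => he.1, ?_, ?_, ?_⟩, by rwa [hcov M hM]⟩
    · intro e he e' he' v hv hv'
      exact hinj he.1 he'.1 (hM.edge_unique he.2 he'.2 hv hv')
    · intro e he v hv
      exact hR v (M.mem_verts_of_mem_edge he.2 hv)
    · intro e he
      obtain ⟨v, hv, h⟩ := hmax (ends e) (hE ▸ Set.mem_image_of_mem _ he)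
      refine ⟨v, hv, h.imp_right fun h => ?_⟩
      rwa [← hcov M hM] at h
  · rintro M N ⟨hM, -⟩ ⟨hN, -⟩ h
    exact hM.prop.1.ext_edgeSet hN.prop.1 (by rw [← hedge M, h, hedge N])
  · rintro F ⟨hF, hP⟩
    have hsub : ends '' F ⊆ G.edgeSet := hE ▸ Set.image_mono hF.subset
    have hset : {e ∈ E | ends e ∈ (subgraphOfEdges G _ hsub).edgeSet} = F := by
      ext e
      rw [edgeSet_subgraphOfEdges]
      constructor
      · rintro ⟨he, e', he', h⟩
        rwa [← hinj (hF.subset he') he h]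
      · exact fun he => ⟨hF.subset he, Set.mem_image_of_mem _ he⟩
    have hM : (subgraphOfEdges G _ hsub).IsMatching := by
      apply subgraphOfEdges_isMatching
      rintro _ ⟨e, he, rfl⟩ _ ⟨e', he', rfl⟩ v hv hv'
      rw [hF.disjoint e he e' he' v hv hv']
    have hverts : (subgraphOfEdges G _ hsub).verts = coveredBy ends F := by
      rw [← hcov _ hM, hset]
    refine ⟨subgraphOfEdges G _ hsub, ⟨isMaximalMatchingDeleting_iff.2 ⟨hM, ?_, ?_⟩, ?_⟩, hset⟩
    · rw [hverts]
      rintro v ⟨e, he, hv⟩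
      exact hF.avoid e he v hv
    · rw [hverts, hE]
      rintro _ ⟨e, he, rfl⟩
      exact hF.maximal e he
    · rwa [hverts]

theorem numMaximalMatchings_eq_ncard_code (G : SimpleGraph V) (ends : ι → Sym2 V) (E : Set ι)
    (hE : G.edgeSet = ends '' E) (hinj : Set.InjOn ends E) :
    numMaximalMatchings G = {F : Set ι | IsMatchingCode ends E ∅ F}.ncard := by
  have := ncard_isMaximalMatchingDeleting G ends E hE hinj ∅ fun _ => True
  simp only [and_true] at this
  rw [← this, numMaximalMatchings]
  simp only [IsMaximalMatchingDeleting, SimpleGraph.Subgraph.deleteVerts_empty, le_top, and_true]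

end Coding

/-! ### The trace of a matrix product as a sum over closed paths. -/

section Trace

open Finset

/-- A term is a path from `x` to `y` through the points of `p`. The whole path is `Fin.cons x
(Fin.snoc p y)`, and dropping its start gives the targets `Fin.snoc p y`. -/
theorem Matrix.prod_ofFn_apply {ι R : Type*} [Fintype ι] [DecidableEq ι] [CommSemiring R] {n : ℕ}
    (A : Fin (n + 1) → Matrix ι ι R) (x y : ι) :
    (List.ofFn A).prod x y = ∑ p : Fin n → ι, ∏ i : Fin (n + 1),
      A i ((Fin.cons x (Fin.snoc p y : Fin (n + 1) → ι) : Fin (n + 2) → ι) i.castSucc)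
        ((Fin.snoc p y : Fin (n + 1) → ι) i) := by
  induction n generalizing x with
  | zero => simp [Fin.snoc]
  | succ n ih =>
    rw [List.ofFn_succ, List.prod_cons, Matrix.mul_apply,
      ← (Fin.consEquiv fun _ : Fin (n + 1) => ι).sum_comp, Fintype.sum_prod_type]
    refine Finset.sum_congr rfl fun z _ => ?_
    rw [ih, Finset.mul_sum]
    refine Finset.sum_congr rfl fun p _ => ?_
    rw [Fin.prod_univ_succ (n := n + 1)]
    have hcons : (Fin.consEquiv fun _ : Fin (n + 1) => ι) (z, p) = Fin.cons z p := rfl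
    simp only [hcons, ← Fin.cons_snoc_eq_snoc_cons, Fin.castSucc_zero, Fin.cons_zero,
      Fin.castSucc_succ, Fin.cons_succ]

theorem Matrix.trace_prod_ofFn {ι R : Type*} [Fintype ι] [DecidableEq ι] [CommSemiring R] {n : ℕ}
    [NeZero n] (A : Fin n → Matrix ι ι R) :
    (List.ofFn A).prod.trace = ∑ q : Fin n → ι, ∏ i, A i (q i) (q (i + 1)) := by
  obtain ⟨n, rfl⟩ := Nat.exists_eq_succ_of_ne_zero (NeZero.ne n)
  rw [← (Fin.consEquiv fun _ : Fin (n + 1) => ι).sum_comp, Fintype.sum_prod_type, Matrix.trace]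
  refine Finset.sum_congr rfl fun x _ => ?_
  rw [Matrix.diag_apply, Matrix.prod_ofFn_apply]
  refine Finset.sum_congr rfl fun p _ => Finset.prod_congr rfl fun i _ => ?_
  simp only [Fin.consEquiv_apply]
  congr 1
  · rw [Fin.cons_snoc_eq_snoc_cons, Fin.snoc_castSucc]
  · induction i using Fin.lastCases with
    -- At the last index `i + 1` wraps around to `0`, which closes the path at `x`.
    | last => simp
    | cast i => simp [Fin.coeSucc_eq_succ]

end Trace

/-! ### Rows and columns as pairs of statuses. -/

section Status

/-- The status of an end of a shared edge as seen from the next face: `free` if it may be covered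
there or not, `needed` if it has to be covered there, `deleted` if it is already covered. -/
inductive EndStatus
  | free
  | needed
  | deleted

namespace EndStatus

/-- The status of an end of a shared edge for which `c` says that it is covered in the face
before, and `s` that its other neighbour in that face is covered. -/
def Holds : EndStatus → Prop → Prop → Prop
  | free, c, s => ¬c ∧ s
  | needed, c, s => ¬c ∧ ¬s
  | deleted, c, _ => c

theorem holds_deleted_iff {σ : EndStatus} {c s : Prop} (h : σ.Holds c s) : σ = deleted ↔ c := by
  cases σ <;> simp_all [Holds]

theorem holds_needed_iff {σ : EndStatus} {c s : Prop} (h : σ.Holds c s) :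
    σ = needed ↔ ¬c ∧ ¬s := by
  cases σ <;> simp_all [Holds]

theorem exists_holds (c s : Prop) : ∃ σ : EndStatus, σ.Holds c s := by
  by_cases hc : c
  · exact ⟨deleted, hc⟩
  · by_cases hs : s
    · exact ⟨free, hc, hs⟩
    · exact ⟨needed, hc, hs⟩

theorem Holds.unique {σ τ : EndStatus} {c s : Prop} (h : σ.Holds c s) (h' : τ.Holds c s) :
    σ = τ := by
  cases σ <;> cases τ <;> simp_all [Holds]

/-- The status of `a` for each of the nine rows. -/
def first : Fin 9 → EndStatus :=
  ![free, deleted, free, deleted, needed, deleted, needed, needed, free]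

/-- The status of `b` for each of the nine rows. -/
def second : Fin 9 → EndStatus :=
  ![free, free, deleted, deleted, needed, needed, deleted, free, needed]

/-- Together with `row_ext`, this identifies the nine indices with the pairs of statuses. -/
theorem exists_row (σ τ : EndStatus) : ∃ x, first x = σ ∧ second x = τ := by
  cases σ <;> cases τ
  exacts [⟨0, rfl, rfl⟩, ⟨8, rfl, rfl⟩, ⟨2, rfl, rfl⟩, ⟨7, rfl, rfl⟩, ⟨4, rfl, rfl⟩, ⟨6, rfl, rfl⟩,
    ⟨1, rfl, rfl⟩, ⟨5, rfl, rfl⟩, ⟨3, rfl, rfl⟩]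

theorem row_ext {x y : Fin 9} (h₁ : first x = first y) (h₂ : second x = second y) : x = y := by
  fin_cases x <;> fin_cases y <;> simp_all [first, second]

end EndStatus

open EndStatus

variable {W : Type*}

theorem mem_rowDeleted_iff (a b v : W) (x : Fin 9) :
    v ∈ rowDeleted a b x ↔ v = a ∧ first x = deleted ∨ v = b ∧ second x = deleted := by
  fin_cases x <;> simp [rowDeleted, first, second]

theorem rowCovered_subset_iff (a b : W) (x : Fin 9) (S : Set W) :
    rowCovered a b x ⊆ S ↔ (first x = needed → a ∈ S) ∧ (second x = needed → b ∈ S) := by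
  fin_cases x <;> simp [rowCovered, first, second, Set.insert_subset_iff]

/-- Here `k₁ ∉ S` stands for "`d` is covered on the cycle". As `dc` is removed, only the edge `ed`
can do this, whence the hypothesis `h₁`; likewise `h₂` at `c`. They supply what the nine conditions
leave unsaid, for example that `e ∉ S` entails `k₁ ∈ S`. -/
theorem columnCondition_iff {k₁ k₂ e f : W} {S : Set W} (h₁ : k₁ ∉ S → e ∈ S)
    (h₂ : k₂ ∉ S → f ∈ S) (y : Fin 9) :
    columnCondition k₁ k₂ e f S y ↔
      (first y).Holds (k₁ ∉ S) (e ∈ S) ∧ (second y).Holds (k₂ ∉ S) (f ∈ S) := by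
  fin_cases y <;> simp [columnCondition, first, second, Holds] <;> tauto

end Status

/-! ### One face: matrix entries in terms of the edges on the cycle. -/

section Local

open EndStatus

variable {m : ℕ}

/-- The vertices of a cycle on the edges `j, j + 1` with `j ∈ f`. -/
def cycleCovered (f : Set (ZMod m)) : Set (ZMod m) := {j | j ∈ f ∨ j - 1 ∈ f}

/-- The vertices of a cycle that are covered, or deleted because of the statuses of `0`, `-1`. -/
def cycleSettled (σ τ : EndStatus) (f : Set (ZMod m)) : Set (ZMod m) :=
  {j | j ∈ cycleCovered f ∨ j = 0 ∧ σ = deleted ∨ j = -1 ∧ τ = deleted}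

/-- `f` is the set of edges on the cycle of a matching counted by an entry of `T_{m,k}`. -/
structure IsFaceCode (m k : ℕ) (σ τ σ' τ' : EndStatus) (f : Set (ZMod m)) : Prop where
  notMem : (k : ZMod m) ∉ f
  disjoint : ∀ j ∈ f, j + 1 ∉ f
  deleted_first : σ = deleted → 0 ∉ cycleCovered f
  deleted_second : τ = deleted → -1 ∉ cycleCovered f
  needed_first : σ = needed → 0 ∈ cycleCovered f
  needed_second : τ = needed → -1 ∈ cycleCovered f
  maximal : ∀ j : ZMod m, j ≠ k - 1 → j ≠ k → j ≠ k + 1 →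
    j ∈ cycleSettled σ τ f ∨ j + 1 ∈ cycleSettled σ τ f
  next_first : σ'.Holds ((k : ZMod m) ∈ cycleCovered f) ((k - 1 : ZMod m) ∈ cycleSettled σ τ f)
  next_second : τ'.Holds ((k + 1 : ZMod m) ∈ cycleCovered f)
    ((k + 2 : ZMod m) ∈ cycleSettled σ τ f)

theorem ZMod.natCast_ne_zero_of_lt {r : ℕ} (h₀ : 0 < r) (h : r < m) : (r : ZMod m) ≠ 0 := by
  rw [Ne, ZMod.natCast_eq_zero_iff]
  exact fun hd => absurd (Nat.le_of_dvd h₀ hd) (by omega)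

/-- The elements of `ZMod m` that have to be distinct in a face of type `t(m,k)`. -/
structure FaceSize (m k : ℕ) : Prop where
  one_ne : (1 : ZMod m) ≠ 0
  two_ne : (2 : ZMod m) ≠ 0
  left_ne : (k : ZMod m) ≠ 0
  left_succ_ne : (k + 1 : ZMod m) ≠ 0
  left_ne_neg : (k : ZMod m) ≠ -1
  left_succ_ne_neg : (k + 1 : ZMod m) ≠ -1

theorem faceSize {k : ℕ} (h₁ : 1 ≤ k) (h₃ : k + 3 ≤ m) : FaceSize m k := by
  have h := fun r h₀ h => ZMod.natCast_ne_zero_of_lt (m := m) (r := r) h₀ h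
  refine ⟨?_, ?_, ?_, ?_, ?_, ?_⟩
  · simpa using h 1 (by omega) (by omega)
  · simpa using h 2 (by omega) (by omega)
  · simpa using h k (by omega) (by omega)
  · simpa using h (k + 1) (by omega) (by omega)
  · have := h (k + 1) (by omega) (by omega)
    push_cast at this
    exact fun h => this (by rw [h]; ring)
  · have := h (k + 2) (by omega) (by omega)
    push_cast at this
    exact fun h => this (by linear_combination h)

/-- The edges of `auxGraph m k`, and the edge `k, k + 1`. -/
def auxEnds (m k : ℕ) : ZMod m ⊕ Fin 2 → Sym2 (ZMod m ⊕ Fin 2)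
  | Sum.inl j => s(Sum.inl j, Sum.inl (j + 1))
  | Sum.inr i => s(Sum.inl (![(k : ZMod m), k + 1] i), Sum.inr i)

theorem edgeSet_auxGraph {k : ℕ} (h : FaceSize m k) :
    (auxGraph m k).edgeSet = auxEnds m k '' {Sum.inl (k : ZMod m)}ᶜ := by
  ext e
  induction e with
  | _ u v =>
    rw [SimpleGraph.mem_edgeSet, auxGraph, SimpleGraph.fromRel_adj]
    constructor
    · rintro ⟨-, (⟨j, hj, rfl, rfl⟩ | ⟨rfl, rfl⟩ | ⟨rfl, rfl⟩) |
        (⟨j, hj, rfl, rfl⟩ | ⟨rfl, rfl⟩ | ⟨rfl, rfl⟩)⟩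
      · exact ⟨Sum.inl j, by simpa using hj, rfl⟩
      · exact ⟨Sum.inr 0, by simp, rfl⟩
      · exact ⟨Sum.inr 1, by simp, rfl⟩
      · exact ⟨Sum.inl j, by simpa using hj, Sym2.eq_swap⟩
      · exact ⟨Sum.inr 0, by simp, Sym2.eq_swap⟩
      · exact ⟨Sum.inr 1, by simp, Sym2.eq_swap⟩
    · rintro ⟨j | i, hj, he⟩
      · have hj' : j ≠ k := by simpa using hj
        simp only [auxEnds, Sym2.eq_iff] at he
        obtain ⟨rfl, rfl⟩ | ⟨rfl, rfl⟩ := he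
        · exact ⟨by simp [h.one_ne], Or.inl (Or.inl ⟨j, hj', rfl, rfl⟩)⟩
        · exact ⟨by simp [h.one_ne], Or.inr (Or.inl ⟨j, hj', rfl, rfl⟩)⟩
      · simp only [auxEnds, Sym2.eq_iff] at he
        fin_cases i
        · obtain ⟨rfl, rfl⟩ | ⟨rfl, rfl⟩ := he <;> simp
        · obtain ⟨rfl, rfl⟩ | ⟨rfl, rfl⟩ := he <;> simp

theorem injective_auxEnds {k : ℕ} (h : FaceSize m k) : Function.Injective (auxEnds m k) := by
  rintro (j | i) (j' | i') he
  · simp only [auxEnds, Sym2.eq_iff, Sum.inl.injEq] at he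
    obtain ⟨rfl, -⟩ | ⟨h₁, h₂⟩ := he
    · rfl
    -- Two cycle edges with their ends swapped would force `2 = 0`.
    · exact absurd (by linear_combination h₂ - h₁) h.two_ne
  · simp [auxEnds] at he
  · simp [auxEnds] at he
  · simp only [auxEnds, Sym2.eq_iff, Sum.inr.injEq, reduceCtorEq, and_false, or_false] at he
    rw [he.2]

section Covered

variable {k : ℕ} {F : Set (ZMod m ⊕ Fin 2)}

theorem inl_mem_coveredBy_auxEnds (j : ZMod m) :
    Sum.inl j ∈ coveredBy (auxEnds m k) F ↔ j ∈ cycleCovered (Sum.inl ⁻¹' F) ∨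
      j = k ∧ Sum.inr 0 ∈ F ∨ j = k + 1 ∧ Sum.inr 1 ∈ F := by
  simp only [coveredBy, cycleCovered, Set.mem_ofPred_eq, Sum.exists, Fin.exists_fin_two, auxEnds,
    Sym2.mem_iff, Sum.inl.injEq, reduceCtorEq, or_false, Set.mem_preimage, Matrix.cons_val_zero,
    Matrix.cons_val_one]
  constructor
  · rintro (⟨i, hi, rfl | rfl⟩ | h | h)
    · exact Or.inl (Or.inl hi)
    · exact Or.inl (Or.inr (by simpa using hi))
    · exact Or.inr (Or.inl h.symm)
    · exact Or.inr (Or.inr h.symm)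
  · rintro ((h | h) | h | h)
    · exact Or.inl ⟨j, h, Or.inl rfl⟩
    · exact Or.inl ⟨j - 1, h, Or.inr (by ring)⟩
    · exact Or.inr (Or.inl h.symm)
    · exact Or.inr (Or.inr h.symm)

theorem inr_mem_coveredBy_auxEnds (i : Fin 2) :
    Sum.inr i ∈ coveredBy (auxEnds m k) F ↔ Sum.inr i ∈ F := by
  fin_cases i <;> simp [coveredBy, auxEnds]

end Covered

section Code

variable {k : ℕ} {F : Set (ZMod m ⊕ Fin 2)} {R : Set (ZMod m ⊕ Fin 2)}

/-- The pendant vertex lies on no other edge. If `d` is not covered on the cycle, then the pendant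
edge can be blocked only by belonging to the matching itself. -/
theorem IsMatchingCode.inr_zero_mem_iff
    (hF : IsMatchingCode (auxEnds m k) {Sum.inl (k : ZMod m)}ᶜ R F) (h : FaceSize m k)
    (hR : Sum.inl (k : ZMod m) ∉ R) (hR' : Sum.inr 0 ∉ R) :
    Sum.inr 0 ∈ F ↔ (k : ZMod m) ∉ cycleCovered (Sum.inl ⁻¹' F) := by
  constructor
  · rintro h₀ (h₁ | h₁)
    · simpa using hF.disjoint _ h₀ _ h₁ (Sum.inl (k : ZMod m)) (by simp [auxEnds])
        (by simp [auxEnds])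
    · simpa using hF.disjoint _ h₀ _ h₁ (Sum.inl (k : ZMod m)) (by simp [auxEnds])
        (by simp [auxEnds])
  · intro hk
    obtain ⟨v, hv, hv' | hv'⟩ := hF.maximal (Sum.inr 0) (by simp)
    · obtain rfl | rfl : v = Sum.inl (k : ZMod m) ∨ v = Sum.inr 0 := by simpa [auxEnds] using hv
      exacts [absurd hv' hR, absurd hv' hR']
    · change v ∈ coveredBy _ F at hv'
      obtain rfl | rfl : v = Sum.inl (k : ZMod m) ∨ v = Sum.inr 0 := by simpa [auxEnds] using hv
      · simpa [inl_mem_coveredBy_auxEnds, hk, h.one_ne] using hv'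
      · exact (inr_mem_coveredBy_auxEnds 0).1 hv'

theorem IsMatchingCode.inr_one_mem_iff
    (hF : IsMatchingCode (auxEnds m k) {Sum.inl (k : ZMod m)}ᶜ R F) (h : FaceSize m k)
    (hR : Sum.inl (k + 1 : ZMod m) ∉ R) (hR' : Sum.inr 1 ∉ R) :
    Sum.inr 1 ∈ F ↔ (k + 1 : ZMod m) ∉ cycleCovered (Sum.inl ⁻¹' F) := by
  constructor
  · rintro h₀ (h₁ | h₁)
    · simpa using hF.disjoint _ h₀ _ h₁ (Sum.inl (k + 1 : ZMod m)) (by simp [auxEnds])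
        (by simp [auxEnds])
    · simpa using hF.disjoint _ h₀ _ h₁ (Sum.inl (k + 1 : ZMod m)) (by simp [auxEnds])
        (by simp [auxEnds])
  · intro hk
    obtain ⟨v, hv, hv' | hv'⟩ := hF.maximal (Sum.inr 1) (by simp)
    · obtain rfl | rfl : v = Sum.inl (k + 1 : ZMod m) ∨ v = Sum.inr 1 := by
        simpa [auxEnds] using hv
      exacts [absurd hv' hR, absurd hv' hR']
    · change v ∈ coveredBy _ F at hv'
      obtain rfl | rfl : v = Sum.inl (k + 1 : ZMod m) ∨ v = Sum.inr 1 := by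
        simpa [auxEnds] using hv
      · simpa [inl_mem_coveredBy_auxEnds, hk, h.one_ne] using hv'
      · exact (inr_mem_coveredBy_auxEnds 1).1 hv'

/-- The extension of a set of edges of the cycle by the pendant edges at uncovered vertices. -/
def auxCode (k : ℕ) (f : Set (ZMod m)) : Set (ZMod m ⊕ Fin 2) :=
  {e | match e with
    | Sum.inl j => j ∈ f
    | Sum.inr i => ![(k : ZMod m), k + 1] i ∉ cycleCovered f}

/-- The entry condition of row `x` and column `y` in terms of the edges on the cycle. -/
theorem isMatchingCode_auxCode_iff (h : FaceSize m k) (f : Set (ZMod m)) (x y : Fin 9) :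
    IsMatchingCode (auxEnds m k) {Sum.inl (k : ZMod m)}ᶜ
        (rowDeleted (Sum.inl 0) (Sum.inl (-1)) x) (auxCode k f) ∧
      rowCovered (Sum.inl 0) (Sum.inl (-1)) x ⊆ coveredBy (auxEnds m k) (auxCode k f) ∧
      columnCondition (Sum.inr 0) (Sum.inr 1) (Sum.inl (k - 1 : ZMod m))
        (Sum.inl (k + 2 : ZMod m)) (coveredBy (auxEnds m k) (auxCode k f) ∪
          rowDeleted (Sum.inl 0) (Sum.inl (-1)) x) y ↔
    IsFaceCode m k (first x) (second x) (first y) (second y) f := by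
  have hk₁ : (k : ZMod m) ≠ k + 1 := by simpa using h.one_ne
  have hpre : Sum.inl ⁻¹' auxCode k f = f := rfl
  have hl : ∀ j : ZMod m, Sum.inl j ∈ auxCode k f ↔ j ∈ f := fun _ => Iff.rfl
  have h₀ : Sum.inr 0 ∈ auxCode k f ↔ (k : ZMod m) ∉ cycleCovered f := Iff.rfl
  have h₁ : Sum.inr 1 ∈ auxCode k f ↔ (k + 1 : ZMod m) ∉ cycleCovered f := Iff.rfl
  have hc : ∀ j : ZMod m, j ≠ k → j ≠ k + 1 →
      (Sum.inl j ∈ coveredBy (auxEnds m k) (auxCode k f) ↔ j ∈ cycleCovered f) := by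
    intro j hj hj'
    simp [inl_mem_coveredBy_auxEnds, hpre, hj, hj']
  have hck : Sum.inl (k : ZMod m) ∈ coveredBy (auxEnds m k) (auxCode k f) := by
    rw [inl_mem_coveredBy_auxEnds, hpre, h₀]
    tauto
  have hck' : Sum.inl (k + 1 : ZMod m) ∈ coveredBy (auxEnds m k) (auxCode k f) := by
    rw [inl_mem_coveredBy_auxEnds, hpre, h₁]
    tauto
  have hr : ∀ (j : ZMod m), Sum.inl j ∈ rowDeleted (W := ZMod m ⊕ Fin 2) (Sum.inl 0)
      (Sum.inl (-1)) x ↔ j = 0 ∧ first x = deleted ∨ j = -1 ∧ second x = deleted := by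
    intro j
    simp [mem_rowDeleted_iff]
  have hr' : ∀ i : Fin 2, Sum.inr i ∉ rowDeleted (W := ZMod m ⊕ Fin 2) (Sum.inl 0)
      (Sum.inl (-1)) x := by
    intro i
    simp [mem_rowDeleted_iff]
  have hs : ∀ j : ZMod m, j ≠ k → j ≠ k + 1 →
      (Sum.inl j ∈ coveredBy (auxEnds m k) (auxCode k f) ∪
        rowDeleted (Sum.inl 0) (Sum.inl (-1)) x ↔
        j ∈ cycleSettled (first x) (second x) f) := by
    intro j hj hj'
    rw [Set.mem_union, hc j hj hj', hr]
    rfl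
  have hs₀ : Sum.inr 0 ∈ coveredBy (auxEnds m k) (auxCode k f) ∪
        rowDeleted (Sum.inl 0) (Sum.inl (-1)) x ↔ (k : ZMod m) ∉ cycleCovered f := by
    rw [Set.mem_union, inr_mem_coveredBy_auxEnds, h₀, or_iff_left (hr' 0)]
  have hs₁ : Sum.inr 1 ∈ coveredBy (auxEnds m k) (auxCode k f) ∪
        rowDeleted (Sum.inl 0) (Sum.inl (-1)) x ↔ (k + 1 : ZMod m) ∉ cycleCovered f := by
    rw [Set.mem_union, inr_mem_coveredBy_auxEnds, h₁, or_iff_left (hr' 1)]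
  have he := hs (k - 1) (fun e => h.one_ne (by linear_combination -e))
    (fun e => h.two_ne (by linear_combination -e))
  have hf := hs (k + 2) (fun e => h.two_ne (by linear_combination e))
    (fun e => h.one_ne (by linear_combination e))
  -- Without the edge `dc`, covering `d` or `c` on the cycle also covers `e` or `f`; these are the
  -- hypotheses of `columnCondition_iff`.
  have hcol : (k : ZMod m) ∉ f →
      (columnCondition (Sum.inr 0) (Sum.inr 1) (Sum.inl (k - 1 : ZMod m))
        (Sum.inl (k + 2 : ZMod m)) (coveredBy (auxEnds m k) (auxCode k f) ∪
          rowDeleted (Sum.inl 0) (Sum.inl (-1)) x) y ↔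
        (first y).Holds ((k : ZMod m) ∈ cycleCovered f)
          ((k - 1 : ZMod m) ∈ cycleSettled (first x) (second x) f) ∧
        (second y).Holds ((k + 1 : ZMod m) ∈ cycleCovered f)
          ((k + 2 : ZMod m) ∈ cycleSettled (first x) (second x) f)) := by
    intro hkf
    rw [columnCondition_iff, he, hf, hs₀, hs₁, not_not, not_not]
    · rw [he, hs₀, not_not]
      rintro (hk | hk)
      · exact absurd hk hkf
      · exact Or.inl (Or.inl hk)
    · rw [hf, hs₁, not_not]
      rintro (hk | hk)
      · refine Or.inl (Or.inr ?_)
        rwa [show (k + 2 - 1 : ZMod m) = k + 1 by ring]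
      · rw [add_sub_cancel_right] at hk
        exact absurd hk hkf
  rw [rowCovered_subset_iff, hc 0 h.left_ne.symm h.left_succ_ne.symm,
    hc (-1) h.left_ne_neg.symm h.left_succ_ne_neg.symm]
  constructor
  · rintro ⟨hF, hn, hy⟩
    have hkf : (k : ZMod m) ∉ f := fun hk => hF.subset hk rfl
    have hnot : ∀ v ∈ rowDeleted (Sum.inl 0) (Sum.inl (-1)) x,
        v ∉ coveredBy (auxEnds m k) (auxCode k f) := by
      rintro v hv ⟨e, he, hve⟩
      exact hF.avoid e he v hve hv
    refine ⟨hkf, ?_, ?_, ?_, hn.1, hn.2, ?_, ((hcol hkf).1 hy).1, ((hcol hkf).1 hy).2⟩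
    · intro j hj hj'
      have := hF.disjoint (Sum.inl j) hj (Sum.inl (j + 1)) hj' (Sum.inl (j + 1))
        (by simp [auxEnds]) (by simp [auxEnds])
      simp [h.one_ne] at this
    · intro hx
      rw [← hc 0 h.left_ne.symm h.left_succ_ne.symm]
      exact hnot _ ((hr 0).2 (Or.inl ⟨rfl, hx⟩))
    · intro hx
      rw [← hc (-1) h.left_ne_neg.symm h.left_succ_ne_neg.symm]
      exact hnot _ ((hr (-1)).2 (Or.inr ⟨rfl, hx⟩))
    · intro j hj hj' hj''
      obtain ⟨v, hv, hv'⟩ := hF.maximal (Sum.inl j) (by simpa using hj')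
      have hv'' : v ∈ coveredBy (auxEnds m k) (auxCode k f) ∪
        rowDeleted (Sum.inl 0) (Sum.inl (-1)) x := hv'.symm
      obtain rfl | rfl : v = Sum.inl j ∨ v = Sum.inl (j + 1) := by simpa [auxEnds] using hv
      · exact Or.inl ((hs j hj' hj'').1 hv'')
      · refine Or.inr ((hs (j + 1) (fun e => hj (by linear_combination e))
          (fun e => hj' (by linear_combination e))).1 hv'')
  · intro hf
    refine ⟨⟨?_, ?_, ?_, ?_⟩, ⟨hf.needed_first, hf.needed_second⟩,
      (hcol hf.notMem).2 ⟨hf.next_first, hf.next_second⟩⟩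
    · rintro _ hj rfl
      exact hf.notMem hj
    -- A pendant edge is used only at a vertex that no chosen cycle edge covers.
    · have hcross : ∀ (j : ZMod m) (i : Fin 2) (v : ZMod m ⊕ Fin 2), Sum.inl j ∈ auxCode k f →
          Sum.inr i ∈ auxCode k f → v ∈ auxEnds m k (Sum.inl j) →
          v ∉ auxEnds m k (Sum.inr i) := by
        intro j i v hj hi hv hv'
        have hi' : ![(k : ZMod m), k + 1] i ∉ cycleCovered f := hi
        obtain rfl | rfl : v = Sum.inl j ∨ v = Sum.inl (j + 1) := by simpa [auxEnds] using hv
        · have hv'' : j = ![(k : ZMod m), k + 1] i := by simpa [auxEnds] using hv'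
          exact hi' (hv'' ▸ Or.inl hj)
        · have hv'' : j + 1 = ![(k : ZMod m), k + 1] i := by simpa [auxEnds] using hv'
          refine hi' (hv'' ▸ Or.inr ?_)
          rwa [add_sub_cancel_right]
      rintro (j | i) hj (j' | i') hj' v hv hv'
      · have h₁ : v = Sum.inl j ∨ v = Sum.inl (j + 1) := by simpa [auxEnds] using hv
        have h₂ : v = Sum.inl j' ∨ v = Sum.inl (j' + 1) := by simpa [auxEnds] using hv'
        obtain rfl | rfl := h₁ <;> obtain h₂ | h₂ := h₂ <;> rw [Sum.inl.injEq] at h₂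
        · rw [h₂]
        · subst h₂
          exact absurd hj (hf.disjoint _ hj')
        · subst h₂
          exact absurd hj' (hf.disjoint _ hj)
        · rw [add_right_cancel h₂]
      · exact absurd hv' (hcross j i' v hj hj' hv)
      · exact absurd hv (hcross j' i v hj' hj hv')
      · have h₁ : v = Sum.inl (![(k : ZMod m), k + 1] i) ∨ v = Sum.inr i := by
          simpa [auxEnds] using hv
        have h₂ : v = Sum.inl (![(k : ZMod m), k + 1] i') ∨ v = Sum.inr i' := by
          simpa [auxEnds] using hv'
        have h₃ : (k + 1 : ZMod m) ≠ k := hk₁.symm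
        obtain rfl | rfl := h₁ <;> obtain h₂ | h₂ := h₂
        · fin_cases i <;> fin_cases i' <;> simp_all
        · simp at h₂
        · simp at h₂
        · exact h₂
    · rintro e he' v hv hvR
      have hvc : v ∈ coveredBy (auxEnds m k) (auxCode k f) := ⟨e, he', hv⟩
      obtain ⟨rfl, hx⟩ | ⟨rfl, hx⟩ := (mem_rowDeleted_iff _ _ _ _).1 hvR
      · exact hf.deleted_first hx ((hc 0 h.left_ne.symm h.left_succ_ne.symm).1 hvc)
      · exact hf.deleted_second hx ((hc (-1) h.left_ne_neg.symm h.left_succ_ne_neg.symm).1 hvc)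
    · suffices ∀ e ∈ ({Sum.inl (k : ZMod m)}ᶜ : Set (ZMod m ⊕ Fin 2)), ∃ v ∈ auxEnds m k e,
          v ∈ coveredBy (auxEnds m k) (auxCode k f) ∪
            rowDeleted (Sum.inl 0) (Sum.inl (-1)) x from
        fun e he => (this e he).imp fun v hv => ⟨hv.1, hv.2.symm⟩
      rintro (j | i) hj
      · have hjk : j ≠ k := by simpa using hj
        -- The edges `ed` and `cf` are exempt from `IsFaceCode.maximal`: in `J'` they are always
        -- blocked, since `d` and `c` are covered, if need be by the pendant edges.
        by_cases hj₁ : j = k - 1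
        · exact ⟨Sum.inl k, by simp [auxEnds, hj₁], Or.inl hck⟩
        by_cases hj₂ : j = k + 1
        · exact ⟨Sum.inl (k + 1), by simp [auxEnds, hj₂], Or.inl hck'⟩
        obtain hm | hm := hf.maximal j hj₁ hjk hj₂
        · exact ⟨Sum.inl j, by simp [auxEnds], (hs j hjk hj₂).2 hm⟩
        · exact ⟨Sum.inl (j + 1), by simp [auxEnds],
            (hs (j + 1) (fun e => hj₁ (by linear_combination e))
              (fun e => hjk (by linear_combination e))).2 hm⟩
      · fin_cases i
        · exact ⟨Sum.inl k, by simp [auxEnds], Or.inl hck⟩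
        · exact ⟨Sum.inl (k + 1), by simp [auxEnds], Or.inl hck'⟩

/-- The indices `k` and `k + 1` differ from `0` and `-1`, so `d` and `c` are never deleted and the
cycle part forces the pendant edges. -/
theorem IsMatchingCode.eq_auxCode (h : FaceSize m k) {x : Fin 9}
    (hF : IsMatchingCode (auxEnds m k) {Sum.inl (k : ZMod m)}ᶜ
      (rowDeleted (Sum.inl 0) (Sum.inl (-1)) x) F) : F = auxCode k (Sum.inl ⁻¹' F) := by
  ext (j | i)
  · rfl
  · fin_cases i
    · exact hF.inr_zero_mem_iff h (by simp [mem_rowDeleted_iff, h.left_ne, h.left_ne_neg])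
        (by simp [mem_rowDeleted_iff])
    · exact hF.inr_one_mem_iff h
        (by simp only [mem_rowDeleted_iff, Sum.inl.injEq, h.left_succ_ne, h.left_succ_ne_neg]; simp)
        (by simp [mem_rowDeleted_iff])

theorem transitionMatrix_apply (h : FaceSize m k) (x y : Fin 9) :
    transitionMatrix m k x y =
      {f | IsFaceCode m k (first x) (second x) (first y) (second y) f}.ncard := by
  rw [transitionMatrix, Matrix.of_apply]
  refine (ncard_isMaximalMatchingDeleting (auxGraph m k) (auxEnds m k) {Sum.inl (k : ZMod m)}ᶜ
    (edgeSet_auxGraph h) (injective_auxEnds h).injOn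
    (rowDeleted (Sum.inl 0) (Sum.inl (-1)) x) fun S =>
      rowCovered (Sum.inl 0) (Sum.inl (-1)) x ⊆ S ∧
      columnCondition (Sum.inr 0) (Sum.inr 1) (Sum.inl (k - 1 : ZMod m))
        (Sum.inl (k + 2 : ZMod m)) (S ∪ rowDeleted (Sum.inl 0) (Sum.inl (-1)) x) y).trans ?_
  symm
  refine Set.ncard_congr (fun f _ => auxCode k f) ?_ ?_ ?_
  · intro f hf
    exact (isMatchingCode_auxCode_iff h f x y).2 hf
  · intro f g _ _ hfg
    exact congrArg (Sum.inl ⁻¹' ·) hfg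
  · rintro F hF
    have hF' := hF.1.eq_auxCode h
    refine ⟨Sum.inl ⁻¹' F, (isMatchingCode_auxCode_iff h _ x y).1 ?_, hF'.symm⟩
    rw [← hF']
    exact hF

end Code
end Local

/-! ### The ring: edges and covered vertices face by face. -/

namespace PolygonRing

open EndStatus

variable {V : Type*} {G : SimpleGraph V} {n : ℕ} [NeZero n] {s k : Fin n → ℕ}
  (Z : PolygonRing G s k)

/-- The edges of the faces of a polygon ring. -/
def ends (e : Σ i, ZMod (s i)) : Sym2 V := s(Z.face e.1 e.2, Z.face e.1 (e.2 + 1))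

/-- The edges of the faces, each glued edge being counted only for the second of its faces. -/
def edges (s k : Fin n → ℕ) : Set (Σ i, ZMod (s i)) := {e | e.2 ≠ (k e.1 : ZMod (s e.1))}

/-- The edges of a code on one face. -/
def faceCode (F : Set (Σ i, ZMod (s i))) (i : Fin n) : Set (ZMod (s i)) :=
  {j | (⟨i, j⟩ : Σ i, ZMod (s i)) ∈ F}

include Z

theorem size (i : Fin n) : FaceSize (s i) (k i) := faceSize (Z.one_le i) (Z.add_three_le i)

theorem succ_ne (i : Fin n) : i ≠ i + 1 := by
  have h := Z.two_le
  intro e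
  have h₁ : (1 : Fin n) = 0 := by simpa using e.symm
  have h₂ := congrArg Fin.val h₁
  rw [Fin.val_one', Fin.val_zero, Nat.mod_eq_of_lt (by omega)] at h₂
  exact one_ne_zero h₂

theorem edgeSet_eq : G.edgeSet = Z.ends '' edges s k := by
  ext e
  induction e with
  | _ u v =>
    rw [SimpleGraph.mem_edgeSet, Z.adj_iff]
    constructor
    · rintro ⟨i, j, h⟩
      by_cases hj : j = k i
      -- The edge `k i` of face `i` is the edge `-1` of face `i + 1`, run backwards.
      · refine ⟨⟨i + 1, -1⟩, (Z.size (i + 1)).left_ne_neg.symm, ?_⟩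
        rw [h, ends, neg_add_cancel, Z.glue_zero, Z.glue_neg_one, hj, Sym2.eq_swap]
      · exact ⟨⟨i, j⟩, hj, h.symm⟩
    · rintro ⟨⟨i, j⟩, -, h⟩
      exact ⟨i, j, h.symm⟩

theorem injOn_ends : Set.InjOn Z.ends (edges s k) := by
  rintro ⟨i, j⟩ hj ⟨i', j'⟩ hj' h
  by_cases hi : i = i'
  · subst hi
    simp only [ends, Sym2.eq_iff, (Z.face_injective i).eq_iff] at h
    obtain ⟨rfl, -⟩ | ⟨h₁, h₂⟩ := h
    · rfl
    · exact absurd (by linear_combination h₂ - h₁) (Z.size i).two_ne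
  -- Edges of different faces coincide only when glued, and then one of them has the index that
  -- `edges` omits.
  · obtain ⟨-, h₁, -⟩ | ⟨-, h₁, -⟩ := Z.eq_of_edge_eq i i' j j' hi h
    exacts [absurd h₁ hj, absurd h₁ hj']

variable {F : Set (Σ i, ZMod (s i))}

theorem mem_ends_iff (v : V) (i : Fin n) (j : ZMod (s i)) :
    v ∈ Z.ends ⟨i, j⟩ ↔ v = Z.face i j ∨ v = Z.face i (j + 1) := Sym2.mem_iff

theorem exists_of_mem_ends {v : V} {i : Fin n} {j : ZMod (s i)}
    (hF : (⟨i, j⟩ : Σ i, ZMod (s i)) ∈ F) (hv : v ∈ Z.ends ⟨i, j⟩) : ∃ l ∈ cycleCovered (faceCode F i), v = Z.face i l := by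
  obtain h | h := (Z.mem_ends_iff v i j).1 hv
  · exact ⟨j, Or.inl hF, h⟩
  · refine ⟨j + 1, Or.inr ?_, h⟩
    rwa [add_sub_cancel_right]

theorem face_mem_coveredBy {i : Fin n} {j : ZMod (s i)} (h : j ∈ cycleCovered (faceCode F i)) :
    Z.face i j ∈ coveredBy Z.ends F := by
  obtain h | h := h
  · exact ⟨_, h, (Z.mem_ends_iff _ _ _).2 (Or.inl rfl)⟩
  · exact ⟨_, h, (Z.mem_ends_iff _ _ _).2 (Or.inr (by rw [sub_add_cancel]))⟩

theorem face_mem_coveredBy_iff (i : Fin n) (j : ZMod (s i)) :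
    Z.face i j ∈ coveredBy Z.ends F ↔ j ∈ cycleCovered (faceCode F i) ∨
      (j = k i ∧ 0 ∈ cycleCovered (faceCode F (i + 1)) ∨
        j = k i + 1 ∧ -1 ∈ cycleCovered (faceCode F (i + 1))) ∨
      ∃ i', i = i' + 1 ∧ (j = 0 ∧ (k i' : ZMod (s i')) ∈ cycleCovered (faceCode F i') ∨
        j = -1 ∧ (k i' + 1 : ZMod (s i')) ∈ cycleCovered (faceCode F i')) := by
  constructor
  · rintro ⟨⟨i', j'⟩, hF, hv⟩
    obtain ⟨l, hl, he⟩ := Z.exists_of_mem_ends hF hv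
    by_cases hi : i = i'
    · subst hi
      rw [Z.face_injective i he]
      exact Or.inl hl
    · obtain ⟨rfl, ⟨rfl, rfl⟩ | ⟨rfl, rfl⟩⟩ | ⟨rfl, ⟨rfl, rfl⟩ | ⟨rfl, rfl⟩⟩ :=
        Z.eq_of_face_eq i i' j l hi he
      · exact Or.inr (Or.inl (Or.inl ⟨rfl, hl⟩))
      · exact Or.inr (Or.inl (Or.inr ⟨rfl, hl⟩))
      · exact Or.inr (Or.inr ⟨i', rfl, Or.inl ⟨rfl, hl⟩⟩)
      · exact Or.inr (Or.inr ⟨i', rfl, Or.inr ⟨rfl, hl⟩⟩)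
  · rintro (h | (⟨rfl, h⟩ | ⟨rfl, h⟩) | ⟨i', rfl, ⟨rfl, h⟩ | ⟨rfl, h⟩⟩)
    · exact Z.face_mem_coveredBy h
    · rw [← Z.glue_zero]
      exact Z.face_mem_coveredBy h
    · rw [← Z.glue_neg_one]
      exact Z.face_mem_coveredBy h
    · rw [Z.glue_zero]
      exact Z.face_mem_coveredBy h
    · rw [Z.glue_neg_one]
      exact Z.face_mem_coveredBy h

/-- As `k i` is neither `0` nor `-1`, the term for the previous face drops out. -/
theorem face_left_mem_coveredBy_iff (i : Fin n) :
    Z.face i (k i) ∈ coveredBy Z.ends F ↔ (k i : ZMod (s i)) ∈ cycleCovered (faceCode F i) ∨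
      0 ∈ cycleCovered (faceCode F (i + 1)) := by
  rw [face_mem_coveredBy_iff]
  have h := Z.size i
  simp [h.left_ne, h.left_ne_neg, h.one_ne]

theorem face_left_succ_mem_coveredBy_iff (i : Fin n) :
    Z.face i (k i + 1) ∈ coveredBy Z.ends F ↔
      (k i + 1 : ZMod (s i)) ∈ cycleCovered (faceCode F i) ∨
      -1 ∈ cycleCovered (faceCode F (i + 1)) := by
  rw [face_mem_coveredBy_iff]
  have h := Z.size i
  simp [h.left_succ_ne, h.left_succ_ne_neg, h.one_ne]

/-- If the deleted ends of each face are those covered in the face before, then away from the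
second shared edge the settled vertices of a face are the covered ones of the ring. -/
theorem face_mem_coveredBy_iff_cycleSettled {q : Fin n → Fin 9}
    (h₁ : ∀ i, first (q (i + 1)) = deleted ↔ (k i : ZMod (s i)) ∈ cycleCovered (faceCode F i))
    (h₂ : ∀ i, second (q (i + 1)) = deleted ↔
      (k i + 1 : ZMod (s i)) ∈ cycleCovered (faceCode F i))
    {i : Fin n} {j : ZMod (s i)} (hj : j ≠ k i) (hj' : j ≠ k i + 1) :
    Z.face i j ∈ coveredBy Z.ends F ↔
      j ∈ cycleSettled (first (q i)) (second (q i)) (faceCode F i) := by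
  rw [face_mem_coveredBy_iff]
  constructor
  · rintro (h | (⟨h, -⟩ | ⟨h, -⟩) | ⟨i', rfl, ⟨h, h'⟩ | ⟨h, h'⟩⟩)
    · exact Or.inl h
    · exact absurd h hj
    · exact absurd h hj'
    · exact Or.inr (Or.inl ⟨h, (h₁ i').2 h'⟩)
    · exact Or.inr (Or.inr ⟨h, (h₂ i').2 h'⟩)
  · obtain ⟨i', rfl⟩ : ∃ i', i = i' + 1 := ⟨i - 1, by simp⟩
    rintro (h | ⟨h, h'⟩ | ⟨h, h'⟩)
    · exact Or.inl h
    · exact Or.inr (Or.inr ⟨i', rfl, Or.inl ⟨h, (h₁ i').1 h'⟩⟩)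
    · exact Or.inr (Or.inr ⟨i', rfl, Or.inr ⟨h, (h₂ i').1 h'⟩⟩)

theorem pred_left_ne (i : Fin n) :
    (k i - 1 : ZMod (s i)) ≠ k i ∧ (k i - 1 : ZMod (s i)) ≠ k i + 1 :=
  ⟨fun e => (Z.size i).one_ne (by linear_combination -e),
    fun e => (Z.size i).two_ne (by linear_combination -e)⟩

theorem succ_right_ne (i : Fin n) :
    (k i + 2 : ZMod (s i)) ≠ k i ∧ (k i + 2 : ZMod (s i)) ≠ k i + 1 :=
  ⟨fun e => (Z.size i).two_ne (by linear_combination e),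
    fun e => (Z.size i).one_ne (by linear_combination e)⟩

/-! ### Gluing face codes along the statuses. -/

/-- `F` is composed of face codes with the statuses given by the rows `q`. -/
def IsComposed (_ : PolygonRing G s k) (q : Fin n → Fin 9) (F : Set (Σ i, ZMod (s i))) : Prop :=
  ∀ i, IsFaceCode (s i) (k i) (first (q i)) (second (q i)) (first (q (i + 1)))
    (second (q (i + 1))) (faceCode F i)

variable {Z}

theorem IsComposed.first_iff {q : Fin n → Fin 9} (h : Z.IsComposed q F) (i : Fin n) :
    first (q (i + 1)) = deleted ↔ (k i : ZMod (s i)) ∈ cycleCovered (faceCode F i) :=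
  holds_deleted_iff (h i).next_first

theorem IsComposed.second_iff {q : Fin n → Fin 9} (h : Z.IsComposed q F) (i : Fin n) :
    second (q (i + 1)) = deleted ↔ (k i + 1 : ZMod (s i)) ∈ cycleCovered (faceCode F i) :=
  holds_deleted_iff (h i).next_second

theorem IsComposed.settled_iff {q : Fin n → Fin 9} (h : Z.IsComposed q F) {i : Fin n}
    {j : ZMod (s i)} (hj : j ≠ k i ∧ j ≠ k i + 1) :
    Z.face i j ∈ coveredBy Z.ends F ↔
      j ∈ cycleSettled (first (q i)) (second (q i)) (faceCode F i) :=
  Z.face_mem_coveredBy_iff_cycleSettled h.first_iff h.second_iff hj.1 hj.2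

/-- The statuses passed on by face `i` seem to depend on `q i` through `cycleSettled`. At the
relevant neighbours, being settled means being covered in the ring, which depends on `F` alone; this
breaks the circularity. -/
theorem IsComposed.unique {q q' : Fin n → Fin 9} (h : Z.IsComposed q F)
    (h' : Z.IsComposed q' F) : q = q' := by
  funext i
  obtain ⟨i, rfl⟩ : ∃ i', i = i' + 1 := ⟨i - 1, by simp⟩
  have h₁ := (h i).next_first
  have h₁' := (h' i).next_first
  have h₂ := (h i).next_second
  have h₂' := (h' i).next_second
  rw [← h.settled_iff (Z.pred_left_ne i)] at h₁
  rw [← h'.settled_iff (Z.pred_left_ne i)] at h₁'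
  rw [← h.settled_iff (Z.succ_right_ne i)] at h₂
  rw [← h'.settled_iff (Z.succ_right_ne i)] at h₂'
  exact row_ext (h₁.unique h₁') (h₂.unique h₂')

/-- The status `deleted` keeps two faces from covering a shared end twice, and `needed` ensures
maximality at the edges `ed` and `cf`, which `IsFaceCode.maximal` leaves open. -/
theorem IsComposed.isMatchingCode {q : Fin n → Fin 9} (h : Z.IsComposed q F) :
    IsMatchingCode Z.ends (edges s k) ∅ F := by
  refine ⟨?_, ?_, fun _ _ _ _ => Set.notMem_empty _, ?_⟩
  · rintro ⟨i, j⟩ hj (rfl : j = k i)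
    exact (h i).notMem hj
  · have hglue : ∀ i j l, Z.face i j = Z.face (i + 1) l → j ∈ cycleCovered (faceCode F i) →
        l ∈ cycleCovered (faceCode F (i + 1)) →
        ¬(j = k i ∧ l = 0 ∨ j = k i + 1 ∧ l = -1) := by
      rintro i j l - hj hl (⟨rfl, rfl⟩ | ⟨rfl, rfl⟩)
      · exact (h (i + 1)).deleted_first ((h.first_iff i).2 hj) hl
      · exact (h (i + 1)).deleted_second ((h.second_iff i).2 hj) hl
    rintro ⟨i, j⟩ hj ⟨i', j'⟩ hj' v hv hv'
    by_cases hi : i = i'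
    · subst hi
      rw [mem_ends_iff] at hv hv'
      obtain rfl | rfl := hv <;> obtain h₂ | h₂ := hv' <;>
        replace h₂ := Z.face_injective i h₂
      · rw [h₂]
      · subst h₂
        exact absurd hj ((h i).disjoint _ hj')
      · subst h₂
        exact absurd hj' ((h i).disjoint _ hj)
      · rw [add_right_cancel h₂]
    · obtain ⟨l, hl, rfl⟩ := Z.exists_of_mem_ends hj hv
      obtain ⟨l', hl', he⟩ := Z.exists_of_mem_ends hj' hv'
      obtain ⟨rfl, hg⟩ | ⟨rfl, hg⟩ := Z.eq_of_face_eq i i' l l' hi he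
      · exact absurd hg (hglue i l l' he hl hl')
      · exact absurd hg (hglue i' l' l he.symm hl' hl)
  · suffices ∀ e ∈ edges s k, ∃ v ∈ Z.ends e, v ∈ coveredBy Z.ends F from
      fun e he => (this e he).imp fun v hv => ⟨hv.1, Or.inr hv.2⟩
    rintro ⟨i, j⟩ (hj : j ≠ k i)
    by_cases hj₁ : j = k i - 1
    · subst hj₁
      by_cases he : Z.face i (k i - 1) ∈ coveredBy Z.ends F
      · exact ⟨_, (Z.mem_ends_iff _ _ _).2 (Or.inl rfl), he⟩
      · refine ⟨_, (Z.mem_ends_iff _ _ _).2 (Or.inr rfl), ?_⟩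
        rw [sub_add_cancel, face_left_mem_coveredBy_iff]
        -- With `d` and `e` both uncovered in face `i`, the status is `needed`, so face `i + 1`
        -- covers `d`.
        by_contra! hcon
        rw [h.settled_iff (Z.pred_left_ne i)] at he
        exact hcon.2 ((h (i + 1)).needed_first
          ((holds_needed_iff (h i).next_first).2 ⟨hcon.1, he⟩))
    by_cases hj₂ : j = k i + 1
    · subst hj₂
      by_cases hf : Z.face i (k i + 2) ∈ coveredBy Z.ends F
      · refine ⟨_, (Z.mem_ends_iff _ _ _).2 (Or.inr rfl), ?_⟩
        rwa [show (k i + 1 + 1 : ZMod (s i)) = k i + 2 by ring]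
      · refine ⟨_, (Z.mem_ends_iff _ _ _).2 (Or.inl rfl), ?_⟩
        rw [face_left_succ_mem_coveredBy_iff]
        by_contra! hcon
        rw [h.settled_iff (Z.succ_right_ne i)] at hf
        exact hcon.2 ((h (i + 1)).needed_second
          ((holds_needed_iff (h i).next_second).2 ⟨hcon.1, hf⟩))
    obtain hm | hm := (h i).maximal j hj₁ hj hj₂
    · exact ⟨_, (Z.mem_ends_iff _ _ _).2 (Or.inl rfl), (h.settled_iff ⟨hj, hj₂⟩).2 hm⟩
    · exact ⟨_, (Z.mem_ends_iff _ _ _).2 (Or.inr rfl),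
        (h.settled_iff ⟨fun e => hj₁ (by linear_combination e),
          fun e => hj (by linear_combination e)⟩).2 hm⟩

/-- The statuses are read off from coverage of `e` and `f` in the whole ring, since `cycleSettled`
would presuppose the row of the same face. -/
theorem _root_.IsMatchingCode.exists_isComposed (hF : IsMatchingCode Z.ends (edges s k) ∅ F) :
    ∃ q, Z.IsComposed q F := by
  have hrow : ∀ i, ∃ x : Fin 9,
      (first x).Holds ((k i : ZMod (s i)) ∈ cycleCovered (faceCode F i))
        (Z.face i (k i - 1) ∈ coveredBy Z.ends F) ∧
      (second x).Holds ((k i + 1 : ZMod (s i)) ∈ cycleCovered (faceCode F i))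
        (Z.face i (k i + 2) ∈ coveredBy Z.ends F) := by
    intro i
    obtain ⟨σ, hσ⟩ := exists_holds ((k i : ZMod (s i)) ∈ cycleCovered (faceCode F i))
      (Z.face i (k i - 1) ∈ coveredBy Z.ends F)
    obtain ⟨τ, hτ⟩ := exists_holds ((k i + 1 : ZMod (s i)) ∈ cycleCovered (faceCode F i))
      (Z.face i (k i + 2) ∈ coveredBy Z.ends F)
    obtain ⟨x, rfl, rfl⟩ := exists_row σ τ
    exact ⟨x, hσ, hτ⟩
  choose p hp₁ hp₂ using hrow
  -- The statuses produced by face `i - 1` form the row of face `i`.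
  let q : Fin n → Fin 9 := fun i => p (i - 1)
  have hq : ∀ i, q (i + 1) = p i := fun i => congrArg p (by simp)
  have h₁ : ∀ i, first (q (i + 1)) = deleted ↔
      (k i : ZMod (s i)) ∈ cycleCovered (faceCode F i) := fun i => by
    rw [hq]
    exact holds_deleted_iff (hp₁ i)
  have h₂ : ∀ i, second (q (i + 1)) = deleted ↔
      (k i + 1 : ZMod (s i)) ∈ cycleCovered (faceCode F i) := fun i => by
    rw [hq]
    exact holds_deleted_iff (hp₂ i)
  have hset : ∀ {i : Fin n} {j : ZMod (s i)}, j ≠ k i ∧ j ≠ k i + 1 →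
      (Z.face i j ∈ coveredBy Z.ends F ↔
        j ∈ cycleSettled (first (q i)) (second (q i)) (faceCode F i)) :=
    fun hj => Z.face_mem_coveredBy_iff_cycleSettled h₁ h₂ hj.1 hj.2
  have hcov : ∀ i (j : ZMod (s i)), j ≠ k i →
      Z.face i j ∈ coveredBy Z.ends F ∨ Z.face i (j + 1) ∈ coveredBy Z.ends F := by
    intro i j hj
    obtain ⟨v, hv, hv' | hv'⟩ := hF.maximal ⟨i, j⟩ hj
    · exact absurd hv' (Set.notMem_empty v)
    · obtain rfl | rfl := (Z.mem_ends_iff _ _ _).1 hv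
      exacts [Or.inl hv', Or.inr hv']
  -- Otherwise two members of `F`, indexed by different faces, would share a vertex.
  have hdis : ∀ i (j : ZMod (s i)) (l : ZMod (s (i + 1))), Z.face (i + 1) l = Z.face i j →
      j ∈ cycleCovered (faceCode F i) → l ∉ cycleCovered (faceCode F (i + 1)) := by
    intro i j l he hj hl
    have hends : ∀ i (j : ZMod (s i)), j ∈ cycleCovered (faceCode F i) →
        ∃ j', (⟨i, j'⟩ : Σ i, ZMod (s i)) ∈ F ∧ Z.face i j ∈ Z.ends ⟨i, j'⟩ := by
      rintro i j (h | h)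
      · exact ⟨j, h, (Z.mem_ends_iff _ _ _).2 (Or.inl rfl)⟩
      · exact ⟨j - 1, h, (Z.mem_ends_iff _ _ _).2 (Or.inr (by rw [sub_add_cancel]))⟩
    obtain ⟨j', hj', hv⟩ := hends i j hj
    obtain ⟨l', hl', hv'⟩ := hends (i + 1) l hl
    have := hF.disjoint _ hj' _ hl' (Z.face i j) hv (he ▸ hv')
    exact Z.succ_ne i (congrArg Sigma.fst this)
  refine ⟨q, fun i => ⟨fun hk => hF.subset hk rfl, ?_, ?_, ?_, ?_, ?_, ?_, ?_, ?_⟩⟩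
  · intro j hj hj'
    have := hF.disjoint _ hj _ hj' (Z.face i (j + 1)) ((Z.mem_ends_iff _ _ _).2 (Or.inr rfl))
      ((Z.mem_ends_iff _ _ _).2 (Or.inl rfl))
    simp [(Z.size i).one_ne] at this
  · obtain ⟨i, rfl⟩ : ∃ i', i = i' + 1 := ⟨i - 1, by simp⟩
    exact fun h => hdis i _ _ (Z.glue_zero i) ((h₁ i).1 h)
  · obtain ⟨i, rfl⟩ : ∃ i', i = i' + 1 := ⟨i - 1, by simp⟩
    exact fun h => hdis i _ _ (Z.glue_neg_one i) ((h₂ i).1 h)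
  · obtain ⟨i, rfl⟩ : ∃ i', i = i' + 1 := ⟨i - 1, by simp⟩
    rw [hq, holds_needed_iff (hp₁ i)]
    rintro ⟨hc, he⟩
    -- Since `e` is uncovered, maximality at `ed` forces `d` to be covered, and only face `i + 1` is
    -- left to do it.
    have := (hcov i (k i - 1) (Z.pred_left_ne i).1).resolve_left he
    rw [sub_add_cancel, face_left_mem_coveredBy_iff] at this
    exact this.resolve_left hc
  · obtain ⟨i, rfl⟩ : ∃ i', i = i' + 1 := ⟨i - 1, by simp⟩
    rw [hq, holds_needed_iff (hp₂ i)]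
    rintro ⟨hc, hf⟩
    have := hcov i (k i + 1) (by simpa using (Z.size i).one_ne)
    rw [show (k i + 1 + 1 : ZMod (s i)) = k i + 2 by ring] at this
    exact ((Z.face_left_succ_mem_coveredBy_iff i).1 (this.resolve_right hf)).resolve_left hc
  · intro j hj hj' hj''
    rw [← hset ⟨hj', hj''⟩, ← hset ⟨fun e => hj (by linear_combination e),
          fun e => hj' (by linear_combination e)⟩]
    exact hcov i j hj'
  · rw [hq, ← hset (Z.pred_left_ne i)]
    exact hp₁ i
  · rw [hq, ← hset (Z.succ_right_ne i)]
    exact hp₂ i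

/-! ### Counting and conclusion. -/

variable (Z)

theorem ncard_isMatchingCode : {F | IsMatchingCode Z.ends (edges s k) ∅ F}.ncard =
    ∑ q : Fin n → Fin 9, ∏ i, {f | IsFaceCode (s i) (k i) (first (q i)) (second (q i))
      (first (q (i + 1))) (second (q (i + 1))) f}.ncard := by
  -- This makes each `ZMod (s i)` finite, as `Nat.card_sigma` needs finite fibres.
  have : ∀ i, NeZero (s i) := fun i => ⟨by have := Z.add_three_le i; omega⟩
  let φ : (Σ q : Fin n → Fin 9, ∀ i, {f | IsFaceCode (s i) (k i) (first (q i)) (second (q i))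
      (first (q (i + 1))) (second (q (i + 1))) f}) →
      {F | IsMatchingCode Z.ends (edges s k) ∅ F} := fun x =>
    ⟨{e | e.2 ∈ (x.2 e.1).1}, IsComposed.isMatchingCode (q := x.1) fun i => (x.2 i).2⟩
  have hφ : Function.Bijective φ := by
    constructor
    · rintro ⟨q, g⟩ ⟨q', g'⟩ h
      have h' : {e : Σ i, ZMod (s i) | e.2 ∈ (g e.1).1} = {e | e.2 ∈ (g' e.1).1} :=
        congrArg Subtype.val h
      have hg : ∀ i, (g i).1 = (g' i).1 := fun i => congrArg (faceCode · i) h'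
      obtain rfl : q = q' := IsComposed.unique (Z := Z) (F := {e | e.2 ∈ (g e.1).1})
        (fun i => (g i).2) (fun i => by rw [h']; exact (g' i).2)
      congr 1
      funext i
      exact Subtype.ext (hg i)
    · rintro ⟨F, hF⟩
      obtain ⟨q, hq⟩ := hF.exists_isComposed
      exact ⟨⟨q, fun i => ⟨faceCode F i, hq i⟩⟩, rfl⟩
  rw [← Nat.card_coe_set_eq, ← Nat.card_congr (Equiv.ofBijective φ hφ), Nat.card_sigma]
  simp only [Nat.card_pi, Nat.card_coe_set_eq]

end PolygonRing

theorem theorem2 {V : Type*} (G : SimpleGraph V) {n : ℕ} [NeZero n] (s k : Fin n → ℕ)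
    (Z : PolygonRing G s k) :
    numMaximalMatchings G =
      Matrix.trace (List.ofFn fun i : Fin n => transitionMatrix (s i) (k i)).prod := by
  rw [numMaximalMatchings_eq_ncard_code G Z.ends _ Z.edgeSet_eq Z.injOn_ends,
    Z.ncard_isMatchingCode, Matrix.trace_prod_ofFn]
  simp only [transitionMatrix_apply (Z.size _)]
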